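/- Let $m\ge 0$ and $p\ge 1$ be integers. Tensors are third-order, $\mathscr A\in R^{m\times n\times p}$, with frontal slices $A^{(0)},\dots,A^{(p-1)}$ indexed modulo $p$; $\operatorname{bcirc}(\mathscr A)$ is the block matrix whose $(a,b)$ block is $A^{(a-b)}$, and the T-product is $\mathscr A*\mathscr B=\operatorname{fold}(\operatorname{bcirc}(\mathscr A)\operatorname{unfold}(\mathscr B))$, where $\operatorname{unfold}$ stacks the frontal slices and $\operatorname{fold}$ is its inverse. $\mathscr I$ denotes the identity tensor (first slice the identity matrix, the others zero), and inverses are two-sided inverses for $*$. For a complex tensor $\mathscr A$, $\overline\sigma(\mathscr A)$ is its largest T-singular value, that is, the largest singular value of the matrices $\sum_{l=0}^{p-1}e^{-2\pi \mathrm{i} kl/p}A^{(l)}$, $0\le k<p$ (and $0$ if $m=0$). $\mathcal{RH}_\infty^{m\times m\times p}$ is the set of tensors whose entries are real rational functions of $s$ that are proper and have no pole in $\operatorname{Re}s\ge 0$; $\mathscr G(\mathrm{j}\infty)$ denotes the limit of $\mathscr G(s)$ as $s\to\infty$. **Theorem (tensor small gain theorem).** Let $\mathscr G,\mathscr H\in\mathcal{RH}_\infty^{m\times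 m\times p}$ satisfy $$\overline\sigma(\mathscr G(\mathrm{j}\omega))\,\overline\sigma(\mathscr H(\mathrm{j}\omega))<1\qquad\text{for all }\omega\in\mathbb R,$$ and suppose that the same inequality holds at $\omega=\infty$, or, more generally, that the feedback loop is well-posed, i.e. $\mathscr I+\mathscr H(\mathrm{j}\infty)*\mathscr G(\mathrm{j}\infty)$ is T-invertible. Then the feedback interconnection of $\mathscr G$ and $\mathscr H$ is stable: $\mathscr I+\mathscr H*\mathscr G$ is T-invertible over the real rational functions, and $$\mathscr G\,\widetilde\#\,\mathscr H=\begin{bmatrix}(\mathscr I+\mathscr H*\mathscr G)^{-1}&(\mathscr I+\mathscr H*\mathscr G)^{-1}*\mathscr H\\ \mathscr G*(\mathscr I+\mathscr H*\mathscr G)^{-1}&\mathscr G*(\mathscr I+\mathscr H*\mathscr G)^{-1}*\mathscr H\end{bmatrix}\in\mathcal{RH}_\infty^{2m\times 2m\times p}.$$ -/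

import Mathlib

/-- A third-order tensor of size `ι × κ × p` over `R`, given by its `p` frontal slices.
The index of the frontal slices is read modulo `p`. (Products of tensors are always written
`tProd`; the pointwise product of functions is not used.) -/
abbrev Tensor (ι κ : Type*) (p : ℕ) (R : Type*) := Fin p → Matrix ι κ R

namespace Tensor

section Algebra

variable {ι κ μ R : Type*} {p : ℕ}

/-- The block-circulant embedding: the block in block-row `a` and block-column `b` is the
frontal slice with index `a - b` modulo `p`. -/
def bcirc (A : Tensor ι κ p R) : Matrix (Fin p × ι) (Fin p × κ) R :=
  Matrix.of fun a b => A (a.1 - b.1) a.2 b.2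

/-- Stack the frontal slices. -/
def unfold (A : Tensor ι κ p R) : Matrix (Fin p × ι) κ R :=
  Matrix.of fun a j => A a.1 a.2 j

/-- The inverse of `unfold`. -/
def fold (M : Matrix (Fin p × ι) κ R) : Tensor ι κ p R :=
  fun k => Matrix.of fun i j => M (k, i) j

/-- The T-product `fold (bcirc A * unfold B)`. -/
def tProd [Fintype κ] [Semiring R] (A : Tensor ι κ p R) (B : Tensor κ μ p R) : Tensor ι μ p R :=
  fold (bcirc A * unfold B)

/-- The identity tensor: the first frontal slice is the identity, all others vanish. -/
def tId [DecidableEq ι] [NeZero p] [Semiring R] : Tensor ι ι p R :=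
  fun k => if k = 0 then 1 else 0

/-- `X` is a two-sided inverse of `A` for the T-product. -/
def IsTInverse [Fintype ι] [DecidableEq ι] [NeZero p] [Semiring R] (A X : Tensor ι ι p R) : Prop :=
  tProd A X = tId ∧ tProd X A = tId

/-- T-invertibility. -/
def TInvertible [Fintype ι] [DecidableEq ι] [NeZero p] [Semiring R] (A : Tensor ι ι p R) : Prop :=
  ∃ X : Tensor ι ι p R, IsTInverse A X

open Classical in
/-- The T-inverse of a T-invertible tensor (and `0` if `A` is not T-invertible). -/
noncomputable def tInv [Fintype ι] [DecidableEq ι] [NeZero p] [Semiring R]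
    (A : Tensor ι ι p R) : Tensor ι ι p R :=
  if h : TInvertible A then Classical.choose h else 0

/-- The `2 × 2` block tensor, formed frontal slice by frontal slice. -/
def fromBlocks (A B C D : Tensor ι ι p R) : Tensor (ι ⊕ ι) (ι ⊕ ι) p R :=
  fun k => Matrix.fromBlocks (A k) (B k) (C k) (D k)

end Algebra

section SingularValues

variable {m n p : ℕ}

/-- The frontal slices of the discrete Fourier transform of `A` along the third mode, i.e. the
diagonal blocks of `(F ⊗ I) (bcirc A) (Fᴴ ⊗ I)` for the unitary DFT matrix `F`. -/
noncomputable def fourierSlice (A : Tensor (Fin m) (Fin n) p ℂ) (k : Fin p) :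
    Matrix (Fin m) (Fin n) ℂ :=
  ∑ l : Fin p,
    Complex.exp (-(2 * Real.pi * Complex.I * ((k : ℕ) : ℂ) * ((l : ℕ) : ℂ) / (p : ℂ))) • A l

/-- The T-singular values: the singular values, in decreasing order, of the Fourier-domain slices. -/
noncomputable def tSingularValue (A : Tensor (Fin m) (Fin n) p ℂ)
    (k : Fin p) (i : Fin (min m n)) : ℝ :=
  (Matrix.toEuclideanLin (fourierSlice A k)).singularValues i

/-- The largest T-singular value (`0` if there is none). -/
noncomputable def tSigmaMax (A : Tensor (Fin m) (Fin n) p ℂ) : ℝ :=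
  ⨆ q : Fin p × Fin (min m n), tSingularValue A q.1 q.2

end SingularValues

section Transfer

variable {ι κ : Type*} {p : ℕ}

/-- A real rational function is proper and stable: in lowest terms the degree of the numerator is
at most that of the denominator, and there is no pole in the closed right half-plane. -/
def IsProperStable (f : RatFunc ℝ) : Prop :=
  f.num.natDegree ≤ f.denom.natDegree ∧ ∀ s : ℂ, 0 ≤ s.re → Polynomial.aeval s f.denom ≠ 0

/-- The class `RH∞` of real-rational proper stable transfer tensors. -/
def RHinf (ι κ : Type*) (p : ℕ) : Set (Tensor ι κ p (RatFunc ℝ)) :=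
  {G | ∀ k i j, IsProperStable (G k i j)}

/-- The frequency response `G(jω)` at a real frequency `ω`. -/
noncomputable def freqResponse (G : Tensor ι κ p (RatFunc ℝ)) (ω : ℝ) : Tensor ι κ p ℂ :=
  fun k => (G k).map (RatFunc.eval (algebraMap ℝ ℂ) ((ω : ℂ) * Complex.I))

/-- The value at infinity of a proper real rational function. -/
noncomputable def valueAtInfty (f : RatFunc ℝ) : ℝ :=
  f.num.coeff f.denom.natDegree / f.denom.leadingCoeff

/-- The frequency response `G(j∞)` of a proper transfer tensor. -/
noncomputable def freqResponseAtInfty (G : Tensor ι κ p (RatFunc ℝ)) : Tensor ι κ p ℂ :=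
  fun k => (G k).map (fun f => ((valueAtInfty f : ℝ) : ℂ))

variable [Fintype ι] [DecidableEq ι] [NeZero p]

/-- The Gang of Four tensor of the negative feedback interconnection of `G` and `H`. -/
noncomputable def gangOfFour (G H : Tensor ι ι p (RatFunc ℝ)) :
    Tensor (ι ⊕ ι) (ι ⊕ ι) p (RatFunc ℝ) :=
  fromBlocks
    (tInv (tId + tProd H G)) (tProd (tInv (tId + tProd H G)) H)
    (tProd G (tInv (tId + tProd H G))) (tProd (tProd G (tInv (tId + tProd H G))) H)

/-- The feedback interconnection of `G` and `H` is stable: the inverse of `I + H * G` exists over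
the real rational functions, and the Gang of Four tensor belongs to `RH∞`. -/
def FeedbackStable (G H : Tensor ι ι p (RatFunc ℝ)) : Prop :=
  TInvertible (tId + tProd H G) ∧ gangOfFour G H ∈ RHinf (ι ⊕ ι) (ι ⊕ ι) p

end Transfer

end Tensor

/-! `bcirc` turns the T-product into the matrix product, so T-invertibility over a commutative ring
means that the determinant of `bcirc` is a unit. Taken over the ring of proper stable functions,
this gives the inverse and the stability of all four blocks at once. Such a function is a unit when
it vanishes neither on the closed right half-plane nor at infinity (`isUnit_of_eval_ne_zero`). Since
evaluation commutes with determinants, it remains to exclude kernel vectors pointwise.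

The Fourier transform splits a kernel vector at `s` into vectors `v` with `v + H_k(s) G_k(s) v = 0`.
If `v ≠ 0`, freeze `w = G_k(s) v` and consider the scalar function `F(z) = ⟨w, G_k(z) v⟩ ⟨v, H_k(z)
w⟩`. By Cauchy–Schwarz and the gain condition, `|F| < (‖w‖ ‖v‖)²` on the imaginary axis, and
Phragmén–Lindelöf with the maximum principle carries this strict bound to `s`. But `H_k(s) w = -v`
gives `|F(s)| = (‖w‖ ‖v‖)²`. At infinity, either the gain inequality or well-posedness applies
directly. -/

namespace Tensor

/-! ### Block-circulant matrices and T-invertibility. -/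

section BlockCirculant

variable {ι κ μ R S : Type*} {p : ℕ}

/-- Apply a map to every entry of a tensor. -/
def map (f : R → S) (A : Tensor ι κ p R) : Tensor ι κ p S := fun k => (A k).map f

theorem bcirc_map (f : R → S) (A : Tensor ι κ p R) : bcirc (A.map f) = (bcirc A).map f := rfl

theorem tProd_apply [Fintype κ] [Semiring R] (A : Tensor ι κ p R) (B : Tensor κ μ p R)
    (k : Fin p) (i : ι) (j : μ) :
    tProd A B k i j = ∑ c, ∑ x, A (k - c) i x * B c x j := by
  simp [tProd, fold, bcirc, unfold, Matrix.mul_apply, Fintype.sum_prod_type]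

theorem map_tProd [Fintype κ] [Semiring R] [Semiring S] (f : R →+* S) (A : Tensor ι κ p R)
    (B : Tensor κ μ p R) : (tProd A B).map f = tProd (A.map f) (B.map f) := by
  ext k i j
  simp [map, tProd_apply, map_sum]

theorem map_add [Semiring R] [Semiring S] (f : R →+* S) (A B : Tensor ι κ p R) :
    (A + B).map f = A.map f + B.map f := by
  ext k i j
  simp [map]

theorem bcirc_add [Semiring R] (A B : Tensor ι κ p R) : bcirc (A + B) = bcirc A + bcirc B := rfl

theorem det_bcirc_map [Fintype ι] [DecidableEq ι] [CommRing R] [CommRing S] (f : R →+* S) (A : Tensor ι ι p R) :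
    (bcirc (A.map f)).det = f (bcirc A).det := by
  rw [bcirc_map, RingHom.map_det]
  rfl

variable [NeZero p]

theorem map_tId [DecidableEq ι] [Semiring R] [Semiring S] (f : R →+* S) :
    (tId : Tensor ι ι p R).map f = tId := by
  ext k i j
  by_cases hk : k = 0 <;> simp [map, tId, hk, Matrix.one_apply, apply_ite f]

theorem bcirc_injective : Function.Injective (bcirc : Tensor ι κ p R → _) := by
  intro A B h
  ext k i j
  simpa [bcirc] using congrFun (congrFun h (k, i)) (0, j)

theorem bcirc_tProd [Fintype κ] [Semiring R] (A : Tensor ι κ p R) (B : Tensor κ μ p R) :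
    bcirc (tProd A B) = bcirc A * bcirc B := by
  ext ⟨a, i⟩ ⟨b, j⟩
  simp only [bcirc, Matrix.of_apply, tProd_apply, Matrix.mul_apply, Fintype.sum_prod_type]
  refine Fintype.sum_equiv (Equiv.addRight b) _ _ fun c => ?_
  simp [sub_sub, add_comm]

theorem bcirc_tId [DecidableEq ι] [Semiring R] : bcirc (tId : Tensor ι ι p R) = 1 := by
  ext ⟨a, i⟩ ⟨b, j⟩
  by_cases h : a = b <;> simp [bcirc, tId, Matrix.one_apply, h, sub_eq_zero]

variable [Fintype ι] [DecidableEq ι]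

theorem isTInverse_iff_bcirc [Semiring R] {A X : Tensor ι ι p R} :
    IsTInverse A X ↔ bcirc A * bcirc X = 1 ∧ bcirc X * bcirc A = 1 := by
  rw [IsTInverse, ← bcirc_injective.eq_iff, ← bcirc_injective.eq_iff (a := tProd X A),
    bcirc_tProd, bcirc_tProd, bcirc_tId]

theorem IsTInverse.tInv_eq [Semiring R] {A X : Tensor ι ι p R} (h : IsTInverse A X) :
    tInv A = X := by
  have hA : TInvertible A := ⟨X, h⟩
  have hY : IsTInverse A (tInv A) := by
    rw [tInv, dif_pos hA]
    exact Classical.choose_spec hA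
  apply bcirc_injective
  exact left_inv_eq_right_inv (isTInverse_iff_bcirc.1 hY).2 (isTInverse_iff_bcirc.1 h).1

theorem IsTInverse.map [Semiring R] [Semiring S] (f : R →+* S) {A X : Tensor ι ι p R}
    (h : IsTInverse A X) : IsTInverse (A.map f) (X.map f) := by
  constructor
  · rw [← map_tProd, h.1, map_tId]
  · rw [← map_tProd, h.2, map_tId]

/-- A tensor over a commutative ring is T-invertible if and only if the determinant of its
block-circulant matrix is a unit. -/
theorem tInvertible_iff_isUnit_det [CommRing R] {A : Tensor ι ι p R} :
    TInvertible A ↔ IsUnit (bcirc A).det := by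
  constructor
  · rintro ⟨X, hX⟩
    rw [← Matrix.isUnit_iff_isUnit_det]
    exact IsUnit.of_mul_eq_one _ (isTInverse_iff_bcirc.1 hX).1
  · intro h
    -- Block column `0` of the inverse matrix already determines a right T-inverse, so the inverse
    -- need not first be shown to be block-circulant.
    let X : Tensor ι ι p R := fun k => Matrix.of fun i j => (bcirc A)⁻¹ (k, i) (0, j)
    have hX : tProd A X = tId := by
      ext k i j
      have h1 := congrFun (congrFun (Matrix.mul_nonsing_inv _ h) (k, i)) (0, j)
      have h2 : bcirc (tId : Tensor ι ι p R) (k, i) (0, j) = tId k i j := by simp [bcirc]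
      rw [← bcirc_tId, h2] at h1
      exact h1
    have hX' : bcirc A * bcirc X = 1 := by rw [← bcirc_tProd, hX, bcirc_tId]
    exact ⟨X, isTInverse_iff_bcirc.2 ⟨hX', mul_eq_one_comm.1 hX'⟩⟩

end BlockCirculant

/-! ### Block diagonalization by the discrete Fourier transform. -/

section Fourier

variable {m n p : ℕ}

/-- The characters of `ℤ/p` that occur in the discrete Fourier transform. -/
noncomputable def fourierRoot (k : Fin p) : ℂ :=
  Complex.exp (2 * Real.pi * Complex.I / p) ^ (-((k : ℕ) : ℤ))

theorem exp_eq_fourierRoot_pow (k l : Fin p) :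
    Complex.exp (-(2 * Real.pi * Complex.I * ((k : ℕ) : ℂ) * ((l : ℕ) : ℂ) / (p : ℂ))) =
      fourierRoot k ^ (l : ℕ) := by
  rw [fourierRoot, ← Complex.exp_int_mul, ← Complex.exp_nat_mul]
  congr 1
  push_cast
  ring

theorem fourierSlice_eq (A : Tensor (Fin m) (Fin n) p ℂ) (k : Fin p) :
    fourierSlice A k = ∑ l : Fin p, fourierRoot k ^ (l : ℕ) • A l := by
  simp only [fourierSlice, exp_eq_fourierRoot_pow]

variable [NeZero p]

theorem fourierRoot_pow_card (k : Fin p) : fourierRoot k ^ p = 1 := by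
  have h := (Complex.isPrimitiveRoot_exp p (NeZero.ne p)).pow_eq_one
  rw [fourierRoot, ← zpow_natCast, zpow_comm, zpow_natCast, h, one_zpow]

theorem fourierRoot_injective : Function.Injective (fourierRoot : Fin p → ℂ) := by
  intro a b h
  have hp := Complex.isPrimitiveRoot_exp p (NeZero.ne p)
  simp only [fourierRoot, zpow_neg, zpow_natCast, inv_inj] at h
  exact Fin.ext (hp.pow_inj a.2 b.2 h)

/-- Subtraction in `Fin p` wraps around, which is harmless because `fourierRoot k` is a `p`-th root
of unity. -/
theorem fourierRoot_pow_sub_mul (k a b : Fin p) :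
    fourierRoot k ^ ((a - b : Fin p) : ℕ) * fourierRoot k ^ (b : ℕ) = fourierRoot k ^ (a : ℕ) := by
  have h : ((a - b : Fin p) : ℕ) + b ≡ a [MOD p] := by
    have h2 := congrArg Fin.val (sub_add_cancel a b)
    rw [Fin.val_add] at h2
    rw [Nat.ModEq, h2, Nat.mod_eq_of_lt a.2]
  rw [← pow_add]
  exact pow_eq_pow_of_modEq h (fourierRoot_pow_card k)

/-- The discrete Fourier transform of a stacked vector. -/
noncomputable def fourierVec (v : Fin p × Fin m → ℂ) (k : Fin p) (i : Fin m) : ℂ :=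
  ∑ l : Fin p, fourierRoot k ^ (l : ℕ) * v (l, i)

/-- The transform is a Vandermonde system with distinct nodes. -/
theorem fourierVec_injective {v : Fin p × Fin m → ℂ} (h : ∀ k, fourierVec v k = 0) : v = 0 := by
  ext ⟨l, i⟩
  refine congrFun (Matrix.eq_zero_of_forall_index_sum_mul_pow_eq_zero
    (v := fun l => v (l, i)) (fourierRoot_injective (p := p)) fun k => ?_) l
  simpa [fourierVec, mul_comm] using congrFun (h k) i

/-- The convolution theorem: substituting `a ↦ a - b` separates the double sum. -/
theorem fourierVec_bcirc_mulVec (A : Tensor (Fin m) (Fin n) p ℂ) (v : Fin p × Fin n → ℂ)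
    (k : Fin p) :
    fourierVec ((bcirc A).mulVec v) k = (fourierSlice A k).mulVec (fourierVec v k) := by
  ext i
  simp only [fourierVec, Matrix.mulVec, dotProduct, bcirc, Matrix.of_apply, fourierSlice_eq,
    Fintype.sum_prod_type, Matrix.sum_apply, Matrix.smul_apply, smul_eq_mul]
  simp only [Finset.mul_sum, Finset.sum_mul]
  rw [Finset.sum_comm]
  conv_rhs => rw [Finset.sum_comm' (t' := Finset.univ) (s' := fun _ => Finset.univ) (by simp)]
  refine Finset.sum_congr rfl fun b _ => ?_
  rw [Finset.sum_comm]
  refine Finset.sum_congr rfl fun x _ => ?_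
  refine Fintype.sum_equiv (Equiv.subRight b) _ _ fun a => ?_
  rw [Equiv.subRight_apply, ← fourierRoot_pow_sub_mul k a b]
  ring

theorem det_bcirc_feedback_ne_zero (G H : Tensor (Fin m) (Fin m) p ℂ)
    (h : ∀ k v, v + (fourierSlice H k).mulVec ((fourierSlice G k).mulVec v) = 0 → v = 0) :
    (bcirc (tId + tProd H G)).det ≠ 0 := by
  intro hdet
  obtain ⟨v, hv, hv0⟩ := Matrix.exists_mulVec_eq_zero_iff.2 hdet
  refine hv (fourierVec_injective fun k => h k _ ?_)
  rw [← fourierVec_bcirc_mulVec, ← fourierVec_bcirc_mulVec]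
  rw [bcirc_add, bcirc_tId, bcirc_tProd, Matrix.add_mulVec, Matrix.one_mulVec,
    ← Matrix.mulVec_mulVec] at hv0
  ext i
  have h2 : ∀ l, v (l, i) + (bcirc H).mulVec ((bcirc G).mulVec v) (l, i) = 0 :=
    fun l => congrFun hv0 (l, i)
  simp only [fourierVec, Pi.add_apply, ← Finset.sum_add_distrib, ← mul_add, h2, mul_zero,
    Finset.sum_const_zero, Pi.zero_apply]

end Fourier

/-! ### Singular values as operator bounds. -/

section SingularValues

/-- A linear map is bounded by any bound of its singular values. -/
theorem norm_apply_le_of_singularValues_le {E F : Type*} [NormedAddCommGroup E]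
    [InnerProductSpace ℂ E] [FiniteDimensional ℂ E] [NormedAddCommGroup F]
    [InnerProductSpace ℂ F] [FiniteDimensional ℂ F] (T : E →ₗ[ℂ] F) {n : ℕ}
    (hn : Module.finrank ℂ E = n) {σ : ℝ} (hσ : 0 ≤ σ) (h : ∀ i : Fin n, T.singularValues i ≤ σ)
    (v : E) : ‖T v‖ ≤ σ * ‖v‖ := by
  have hS := T.isSymmetric_adjoint_comp_self
  let b := hS.eigenvectorBasis hn
  -- Expand `⟨v, T*T v⟩` in an orthonormal eigenbasis of `T*T`, whose eigenvalues are the squared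
  -- singular values.
  have h1 : (‖T v‖ ^ 2 : ℝ) = ∑ i, hS.eigenvalues hn i * ‖inner ℂ (b i) v‖ ^ 2 := by
    have h2 : ((‖T v‖ ^ 2 : ℝ) : ℂ) = inner ℂ v ((LinearMap.adjoint T ∘ₗ T) v) := by
      rw [LinearMap.comp_apply, LinearMap.adjoint_inner_right, inner_self_eq_norm_sq_to_K]
      push_cast
      rfl
    rw [← b.sum_inner_mul_inner] at h2
    have h3 : ∀ i, inner ℂ v (b i) * inner ℂ (b i) ((LinearMap.adjoint T ∘ₗ T) v) =
        ((hS.eigenvalues hn i * ‖inner ℂ (b i) v‖ ^ 2 : ℝ) : ℂ) := by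
      intro i
      rw [← hS (b i) v, hS.apply_eigenvectorBasis hn i, inner_smul_left,
        ← inner_conj_symm v (b i), mul_left_comm, RCLike.conj_mul]
      push_cast
      simp [b]
    simp only [h3] at h2
    exact_mod_cast h2
  refine le_of_sq_le_sq ?_ (by positivity)
  rw [h1, mul_pow, ← b.sum_sq_norm_inner_right v, Finset.mul_sum]
  refine Finset.sum_le_sum fun i _ => mul_le_mul_of_nonneg_right ?_ (by positivity)
  rw [← T.sq_singularValues_fin hn i]
  exact pow_le_pow_left₀ (T.singularValues_nonneg i) (h i) 2

variable {m p : ℕ}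

theorem tSigmaMax_nonneg {n : ℕ} (A : Tensor (Fin m) (Fin n) p ℂ) : 0 ≤ tSigmaMax A :=
  Real.iSup_nonneg fun _ => LinearMap.singularValues_nonneg _ _

theorem norm_fourierSlice_le (A : Tensor (Fin m) (Fin m) p ℂ) (k : Fin p)
    (v : EuclideanSpace ℂ (Fin m)) :
    ‖Matrix.toEuclideanLin (fourierSlice A k) v‖ ≤ tSigmaMax A * ‖v‖ := by
  refine norm_apply_le_of_singularValues_le (n := m) _ (by simp) (tSigmaMax_nonneg A)
    (fun i => ?_) v
  exact le_ciSup (f := fun q : Fin p × Fin (min m m) => tSingularValue A q.1 q.2)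
    (Set.finite_range _).bddAbove (k, Fin.cast (min_self m).symm i)

end SingularValues

end Tensor

/-! ### The ring of proper stable rational functions and its evaluations. -/

namespace Tensor

open Polynomial Filter Topology Bornology

/-- The quotient is the reversed polynomial at `z⁻¹`, and its constant coefficient is `q.coeff D`.
-/
theorem tendsto_eval_div_pow_cobounded (q : ℝ[X]) {D : ℕ} (hq : q.natDegree ≤ D) :
    Tendsto (fun z : ℂ => aeval z q / z ^ D) (cobounded ℂ) (𝓝 (q.coeff D : ℂ)) := by
  have h1 : Tendsto (fun z : ℂ => aeval z⁻¹ (reflect D q)) (cobounded ℂ)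
      (𝓝 (aeval (0 : ℂ) (reflect D q))) :=
    ((Polynomial.continuous_aeval (reflect D q)).tendsto 0).comp tendsto_inv₀_cobounded
  have h2 : aeval (0 : ℂ) (reflect D q) = (q.coeff D : ℂ) := by
    rw [aeval_def, eval₂_at_zero, coeff_reflect, revAt_le (Nat.zero_le D), Nat.sub_zero]
    rfl
  rw [h2] at h1
  refine h1.congr' ?_
  filter_upwards [eventually_ne_cobounded (0 : ℂ)] with z hz
  have : Invertible z := invertibleOfNonzero hz
  rw [eq_div_iff (pow_ne_zero D hz), ← invOf_eq_inv]
  exact eval₂_reflect_mul_pow (algebraMap ℝ ℂ) z D q hq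

theorem tendsto_eval_cobounded {f : RatFunc ℝ} (hf : f.num.natDegree ≤ f.denom.natDegree) :
    Tendsto (fun z : ℂ => f.eval (algebraMap ℝ ℂ) z) (cobounded ℂ)
      (𝓝 (valueAtInfty f : ℂ)) := by
  have hd : (f.denom.leadingCoeff : ℂ) ≠ 0 := by
    simpa using f.denom_ne_zero
  have h := (tendsto_eval_div_pow_cobounded f.num hf).div
    (tendsto_eval_div_pow_cobounded f.denom le_rfl) hd
  rw [valueAtInfty, Complex.ofReal_div]
  refine h.congr' ?_
  filter_upwards [eventually_ne_cobounded (0 : ℂ)] with z hz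
  simp only [Pi.div_apply]
  rw [div_div_div_cancel_right₀ (pow_ne_zero _ hz)]
  rfl

theorem isProperStable_iff {f : RatFunc ℝ} :
    IsProperStable f ↔ f.intDegree ≤ 0 ∧
      ∀ s : ℂ, 0 ≤ s.re → f.denom.eval₂ (algebraMap ℝ ℂ) s ≠ 0 := by
  simp [IsProperStable, RatFunc.intDegree, aeval_def]

theorem eval₂_ne_zero_of_dvd {q r : ℝ[X]} (h : q ∣ r) {s : ℂ}
    (hr : r.eval₂ (algebraMap ℝ ℂ) s ≠ 0) : q.eval₂ (algebraMap ℝ ℂ) s ≠ 0 := by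
  obtain ⟨t, rfl⟩ := h
  rw [eval₂_mul] at hr
  exact left_ne_zero_of_mul hr

/-- The ring of proper stable real rational functions. -/
def properStableSubring : Subring (RatFunc ℝ) where
  carrier := {f | IsProperStable f}
  zero_mem' := by simp [IsProperStable]
  one_mem' := by simp [IsProperStable]
  add_mem' := by
    intro f g hf hg
    rw [Set.mem_ofPred, isProperStable_iff] at *
    refine ⟨?_, fun s hs => eval₂_ne_zero_of_dvd (RatFunc.denom_add_dvd f g) ?_⟩
    · by_cases hg0 : g = 0
      · simpa [hg0] using hf.1
      by_cases hfg : f + g = 0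
      · simp [hfg]
      exact (RatFunc.intDegree_add_le hg0 hfg).trans (max_le hf.1 hg.1)
    · rw [eval₂_mul]
      exact mul_ne_zero (hf.2 s hs) (hg.2 s hs)
  mul_mem' := by
    intro f g hf hg
    rw [Set.mem_ofPred, isProperStable_iff] at *
    refine ⟨?_, fun s hs => eval₂_ne_zero_of_dvd (RatFunc.denom_mul_dvd f g) ?_⟩
    · by_cases hf0 : f = 0
      · simp [hf0]
      by_cases hg0 : g = 0
      · simp [hg0]
      rw [RatFunc.intDegree_mul hf0 hg0]
      exact add_nonpos hf.1 hg.1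
    · rw [eval₂_mul]
      exact mul_ne_zero (hf.2 s hs) (hg.2 s hs)
  neg_mem' := by
    intro f hf
    rw [Set.mem_ofPred, isProperStable_iff] at *
    refine ⟨by rw [RatFunc.intDegree_neg]; exact hf.1, fun s hs =>
      eval₂_ne_zero_of_dvd ?_ (hf.2 s hs)⟩
    rw [RatFunc.denom_dvd f.denom_ne_zero]
    refine ⟨-f.num, ?_⟩
    rw [_root_.map_neg, neg_div, RatFunc.num_div_denom]

theorem eval₂_denom_ne_zero (f : properStableSubring) {s : ℂ} (hs : 0 ≤ s.re) :
    (f : RatFunc ℝ).denom.eval₂ (algebraMap ℝ ℂ) s ≠ 0 :=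
  (isProperStable_iff.1 f.2).2 s hs

/-- Evaluation of proper stable functions at a point of the closed right half-plane. -/
noncomputable def evalAt (s : ℂ) (hs : 0 ≤ s.re) : properStableSubring →+* ℂ where
  toFun f := (f : RatFunc ℝ).eval (algebraMap ℝ ℂ) s
  map_zero' := RatFunc.eval_zero _ _
  map_one' := RatFunc.eval_one _ _
  map_add' f g := RatFunc.eval_add _ _ (eval₂_denom_ne_zero f hs) (eval₂_denom_ne_zero g hs)
  map_mul' f g := RatFunc.eval_mul _ _ (eval₂_denom_ne_zero f hs) (eval₂_denom_ne_zero g hs)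

theorem tendsto_eval_atTop (f : properStableSubring) :
    Tendsto (fun x : ℝ => (f : RatFunc ℝ).eval (algebraMap ℝ ℂ) (x : ℂ)) atTop
      (𝓝 (valueAtInfty (f : RatFunc ℝ) : ℂ)) := by
  refine (tendsto_eval_cobounded f.2.1).comp ?_
  rw [← tendsto_norm_atTop_iff_cobounded]
  simpa using tendsto_abs_atTop_atTop

/-- Evaluation of proper stable functions at infinity. -/
noncomputable def evalAtInfty : properStableSubring →+* ℂ where
  toFun f := (valueAtInfty (f : RatFunc ℝ) : ℂ)
  map_zero' := by simp [valueAtInfty]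
  map_one' := by simp [valueAtInfty]
  map_add' f g := by
    -- Additivity passes to the limit along the positive real axis, where evaluation is a ring
    -- homomorphism.
    refine tendsto_nhds_unique (tendsto_eval_atTop (f + g)) ?_
    refine ((tendsto_eval_atTop f).add (tendsto_eval_atTop g)).congr' ?_
    filter_upwards [eventually_ge_atTop 0] with x hx
    exact ((evalAt x (by simpa using hx)).map_add f g).symm
  map_mul' f g := by
    refine tendsto_nhds_unique (tendsto_eval_atTop (f * g)) ?_
    refine ((tendsto_eval_atTop f).mul (tendsto_eval_atTop g)).congr' ?_
    filter_upwards [eventually_ge_atTop 0] with x hx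
    exact ((evalAt x (by simpa using hx)).map_mul f g).symm

/-- A proper stable function without zeros in the closed right half-plane and at infinity is a
unit of the ring of proper stable functions. -/
theorem isUnit_of_eval_ne_zero {f : properStableSubring} (hf : ∀ s hs, evalAt s hs f ≠ 0)
    (hinf : evalAtInfty f ≠ 0) : IsUnit f := by
  obtain ⟨f, hfS⟩ := f
  have hf0 : f ≠ 0 := by
    rintro rfl
    exact hf 0 le_rfl (RatFunc.eval_zero _ _)
  have hcoeff : f.num.coeff f.denom.natDegree ≠ 0 := by
    intro h
    apply hinf
    change ((valueAtInfty f : ℝ) : ℂ) = 0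
    simp [valueAtInfty, h]
  have hinv : IsProperStable f⁻¹ := by
    refine isProperStable_iff.2 ⟨?_, fun s hs =>
      eval₂_ne_zero_of_dvd (RatFunc.denom_inv_dvd hf0) fun h => ?_⟩
    -- A nonzero value at infinity forces the numerator degree to reach the denominator degree, so
    -- the inverse is proper.
    · rw [RatFunc.intDegree_inv, RatFunc.intDegree]
      have := le_natDegree_of_ne_zero hcoeff
      omega
    · refine hf s hs ?_
      change f.eval (algebraMap ℝ ℂ) s = 0
      rw [RatFunc.eval, h, zero_div]
  exact IsUnit.of_mul_eq_one (⟨f⁻¹, hinv⟩ : properStableSubring)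
    (Subtype.ext (mul_inv_cancel₀ hf0))

theorem differentiableAt_eval (f : properStableSubring) {s : ℂ} (hs : 0 ≤ s.re) :
    DifferentiableAt ℂ (fun z => (f : RatFunc ℝ).eval (algebraMap ℝ ℂ) z) s :=
  ((f : RatFunc ℝ).num.differentiable_aeval s).div
    ((f : RatFunc ℝ).denom.differentiable_aeval s) (eval₂_denom_ne_zero f hs)

theorem eval_isBigO_one (f : properStableSubring) :
    (fun z => (f : RatFunc ℝ).eval (algebraMap ℝ ℂ) z) =O[cobounded ℂ] (1 : ℂ → ℝ) :=
  (tendsto_eval_cobounded f.2.1).isBigO_one ℝ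

end Tensor

/-! ### Maximum principle on the half-plane and the small gain argument. -/

namespace Tensor

open Filter Topology Bornology Asymptotics

/-- A function that is holomorphic on the closed right half-plane and bounded near infinity, and
whose norm is smaller than `C` on the imaginary axis, has norm smaller than `C` everywhere on the
closed right half-plane. -/
theorem norm_lt_of_norm_lt_on_imaginary_axis {F : ℂ → ℂ} {C : ℝ}
    (hd : ∀ s : ℂ, 0 ≤ s.re → DifferentiableAt ℂ F s)
    (hb : F =O[cobounded ℂ] (1 : ℂ → ℝ)) (hF : ∀ ω : ℝ, ‖F (ω * Complex.I)‖ < C)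
    {s : ℂ} (hs : 0 ≤ s.re) : ‖F s‖ < C := by
  have hcl : closure {z : ℂ | 0 < z.re} = {z : ℂ | 0 ≤ z.re} := Complex.closure_setOfPred_lt_re 0
  have hdc : DiffContOnCl ℂ F {z : ℂ | 0 < z.re} := by
    refine DifferentiableOn.diffContOnCl fun z hz => ?_
    rw [hcl] at hz
    exact (hd z hz).differentiableWithinAt
  have hle : ∀ z : ℂ, 0 ≤ z.re → ‖F z‖ ≤ C := by
    intro z hz
    -- With `c = 0` and `B = 0` the allowed growth is the constant `1`.
    refine PhragmenLindelof.right_half_plane_of_bounded_on_real hdc ⟨0, two_pos, 0, ?_⟩ ?_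
      (fun x => (hF x).le) hz
    · refine (hb.mono inf_le_left).congr_right fun z => ?_
      simp
    · have h := hb.comp_tendsto (k := fun x : ℝ => (x : ℂ)) (l' := atTop) (by
        rw [← tendsto_norm_atTop_iff_cobounded]
        simpa using tendsto_abs_atTop_atTop)
      exact h.isBoundedUnder_le
  rcases hs.eq_or_lt with h0 | hpos
  · have : s = (s.im : ℂ) * Complex.I := by
      apply Complex.ext <;> simp [← h0]
    rw [this]
    exact hF _
  · refine (hle s hs).lt_of_ne fun h => ?_
    -- Equality at an interior point would make `‖F‖` constant up to the boundary point `0`, where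
    -- it is strictly below `C`.
    have hmax : IsMaxOn (norm ∘ F) {z : ℂ | 0 < z.re} s := fun z hz => by
      simpa [h] using hle z (le_of_lt hz)
    have h0 := Complex.norm_eqOn_closure_of_isPreconnected_of_isMaxOn
      (convex_halfSpace_re_gt 0).isPreconnected
      (isOpen_lt continuous_const Complex.continuous_re) hdc hpos hmax
      (show (0 : ℂ) ∈ closure {z : ℂ | 0 < z.re} by rw [hcl]; simp)
    have h1 := hF 0
    simp only [Function.comp_apply, Function.const_apply] at h0
    rw [Complex.ofReal_zero, zero_mul, h0, h] at h1
    exact h1.false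

section SmallGain

theorem norm_inner_mul_inner_lt {E : Type*} [NormedAddCommGroup E] [InnerProductSpace ℂ E]
    {A B : E →ₗ[ℂ] E} {a b : ℝ} (ha : 0 ≤ a) (hA : ∀ v, ‖A v‖ ≤ a * ‖v‖)
    (hB : ∀ v, ‖B v‖ ≤ b * ‖v‖) (hab : a * b < 1) {v w : E} (hv : v ≠ 0) (hw : w ≠ 0) :
    ‖inner ℂ w (A v) * inner ℂ v (B w)‖ < (‖w‖ * ‖v‖) ^ 2 := by
  have hpos : 0 < (‖w‖ * ‖v‖) ^ 2 := by positivity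
  calc ‖inner ℂ w (A v) * inner ℂ v (B w)‖
      ≤ (‖w‖ * ‖A v‖) * (‖v‖ * ‖B w‖) := by
        rw [norm_mul]
        exact mul_le_mul (norm_inner_le_norm _ _) (norm_inner_le_norm _ _) (norm_nonneg _)
          (by positivity)
    _ ≤ (‖w‖ * (a * ‖v‖)) * (‖v‖ * (b * ‖w‖)) := by
        gcongr
        exacts [hA v, hB w]
    _ = a * b * (‖w‖ * ‖v‖) ^ 2 := by ring
    _ < (‖w‖ * ‖v‖) ^ 2 := by nlinarith

/-- Since `B (A v) = -v`, the product of inner products has modulus exactly `(‖A v‖ * ‖v‖) ^ 2`. -/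
theorem feedback_eq_zero_of_norm_lt {E : Type*} [NormedAddCommGroup E] [InnerProductSpace ℂ E]
    (A B : E →ₗ[ℂ] E) {v : E} (h : v + B (A v) = 0)
    (hlt : v ≠ 0 → A v ≠ 0 →
      ‖inner ℂ (A v) (A v) * inner ℂ v (B (A v))‖ < (‖A v‖ * ‖v‖) ^ 2) : v = 0 := by
  by_contra hv
  have hw : A v ≠ 0 := by
    intro hw
    rw [hw, map_zero, add_zero] at h
    exact hv h
  have h1 := hlt hv hw
  rw [eq_neg_of_add_eq_zero_right h, inner_neg_right, norm_mul, norm_neg,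
    inner_self_eq_norm_sq_to_K, inner_self_eq_norm_sq_to_K] at h1
  simp [mul_pow] at h1

variable {m p : ℕ}

theorem toEuclideanLin_feedback {A B : Matrix (Fin m) (Fin m) ℂ} {v : Fin m → ℂ}
    (h : v + B.mulVec (A.mulVec v) = 0) :
    WithLp.toLp 2 v + Matrix.toEuclideanLin B (Matrix.toEuclideanLin A (WithLp.toLp 2 v)) = 0 := by
  rw [Matrix.toLpLin_toLp, Matrix.toLpLin_toLp, ← WithLp.toLp_add]
  exact congrArg (WithLp.toLp 2) h

theorem feedback_eq_zero_of_tSigmaMax_mul_lt {A B : Tensor (Fin m) (Fin m) p ℂ}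
    (hAB : tSigmaMax A * tSigmaMax B < 1) (k : Fin p) (v : Fin m → ℂ)
    (h : v + (fourierSlice B k).mulVec ((fourierSlice A k).mulVec v) = 0) : v = 0 := by
  have h1 := feedback_eq_zero_of_norm_lt _ _ (toEuclideanLin_feedback h) fun hv hw =>
    norm_inner_mul_inner_lt (tSigmaMax_nonneg A) (norm_fourierSlice_le A k)
      (norm_fourierSlice_le B k) hAB hv hw
  exact (WithLp.toLp_eq_zero 2).1 h1

/-- The value of a transfer tensor at a complex number. -/
noncomputable def eval {ι κ : Type*} (G : Tensor ι κ p (RatFunc ℝ)) (s : ℂ) : Tensor ι κ p ℂ :=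
  G.map (RatFunc.eval (algebraMap ℝ ℂ) s)

/-- For fixed `v` and `w` this is a constant-coefficient combination of the entries, which therefore
pass on holomorphy and boundedness. -/
theorem inner_fourierSlice_eval (G : Tensor (Fin m) (Fin m) p (RatFunc ℝ)) (k : Fin p)
    (v w : EuclideanSpace ℂ (Fin m)) (z : ℂ) :
    inner ℂ w (Matrix.toEuclideanLin (fourierSlice (eval G z) k) v) =
      ∑ i, ∑ j, ∑ l : Fin p, (fourierRoot k ^ (l : ℕ) * v j * starRingEnd ℂ (w i)) *
        (G l i j).eval (algebraMap ℝ ℂ) z := by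
  simp only [PiLp.inner_apply, Matrix.toLpLin_apply, Matrix.mulVec, dotProduct, fourierSlice_eq,
    Matrix.sum_apply, Matrix.smul_apply, eval, map, Matrix.map_apply, RCLike.inner_apply,
    smul_eq_mul, Finset.sum_mul]
  refine Finset.sum_congr rfl fun i _ => Finset.sum_congr rfl fun j _ =>
    Finset.sum_congr rfl fun l _ => ?_
  ring

theorem differentiableAt_inner_fourierSlice {G : Tensor (Fin m) (Fin m) p (RatFunc ℝ)}
    (hG : G ∈ RHinf (Fin m) (Fin m) p) (k : Fin p) (v w : EuclideanSpace ℂ (Fin m)) {s : ℂ}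
    (hs : 0 ≤ s.re) : DifferentiableAt ℂ
      (fun z => inner ℂ w (Matrix.toEuclideanLin (fourierSlice (eval G z) k) v)) s := by
  simp only [inner_fourierSlice_eval]
  refine DifferentiableAt.fun_sum fun i _ => DifferentiableAt.fun_sum fun j _ =>
    DifferentiableAt.fun_sum fun l _ => ?_
  exact (differentiableAt_eval ⟨G l i j, hG l i j⟩ hs).const_mul _

theorem inner_fourierSlice_isBigO_one {G : Tensor (Fin m) (Fin m) p (RatFunc ℝ)}
    (hG : G ∈ RHinf (Fin m) (Fin m) p) (k : Fin p) (v w : EuclideanSpace ℂ (Fin m)) :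
    (fun z => inner ℂ w (Matrix.toEuclideanLin (fourierSlice (eval G z) k) v))
      =O[cobounded ℂ] (1 : ℂ → ℝ) := by
  simp only [inner_fourierSlice_eval]
  refine IsBigO.fun_sum fun i _ => IsBigO.fun_sum fun j _ => IsBigO.fun_sum fun l _ => ?_
  exact (eval_isBigO_one ⟨G l i j, hG l i j⟩).const_mul_left _

theorem feedback_eq_zero_of_re_nonneg {G H : Tensor (Fin m) (Fin m) p (RatFunc ℝ)}
    (hG : G ∈ RHinf (Fin m) (Fin m) p) (hH : H ∈ RHinf (Fin m) (Fin m) p)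
    (hgain : ∀ ω : ℝ, tSigmaMax (freqResponse G ω) * tSigmaMax (freqResponse H ω) < 1)
    {s : ℂ} (hs : 0 ≤ s.re) (k : Fin p) (v : Fin m → ℂ)
    (h : v + (fourierSlice (eval H s) k).mulVec ((fourierSlice (eval G s) k).mulVec v) = 0) :
    v = 0 := by
  have h1 := feedback_eq_zero_of_norm_lt _ _ (toEuclideanLin_feedback h) fun hv hw => by
    -- `w` stays frozen at its value at `s`: the inner product is conjugate-linear in its first
    -- argument, so a varying `w` would destroy holomorphy.
    set w := Matrix.toEuclideanLin (fourierSlice (eval G s) k) (WithLp.toLp 2 v)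
    have h2 := norm_lt_of_norm_lt_on_imaginary_axis (C := (‖w‖ * ‖WithLp.toLp 2 v‖) ^ 2)
      (F := fun z =>
        inner ℂ w (Matrix.toEuclideanLin (fourierSlice (eval G z) k) (WithLp.toLp 2 v)) *
        inner ℂ (WithLp.toLp 2 v) (Matrix.toEuclideanLin (fourierSlice (eval H z) k) w))
      (fun z hz => (differentiableAt_inner_fourierSlice hG k _ _ hz).mul
        (differentiableAt_inner_fourierSlice hH k _ _ hz))
      (((inner_fourierSlice_isBigO_one hG k (WithLp.toLp 2 v) w).mul
        (inner_fourierSlice_isBigO_one hH k w (WithLp.toLp 2 v))).congr_right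
          fun _ => mul_one _)
      (fun ω => norm_inner_mul_inner_lt (tSigmaMax_nonneg _)
        (norm_fourierSlice_le (freqResponse G ω) k)
        (norm_fourierSlice_le (freqResponse H ω) k) (hgain ω) hv hw) hs
    exact h2
  exact (WithLp.toLp_eq_zero 2).1 h1

theorem exists_map_subtype_eq {ι κ : Type*} {A : Tensor ι κ p (RatFunc ℝ)}
    (hA : A ∈ RHinf ι κ p) :
    ∃ A' : Tensor ι κ p properStableSubring, A'.map properStableSubring.subtype = A :=
  ⟨fun k i j => ⟨A k i j, hA k i j⟩, rfl⟩

theorem map_subtype_mem_RHinf {ι κ : Type*} (A : Tensor ι κ p properStableSubring) :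
    A.map properStableSubring.subtype ∈ RHinf ι κ p :=
  fun k i j => (A k i j).2

theorem fromBlocks_mem_RHinf {ι : Type*} {A B C D : Tensor ι ι p (RatFunc ℝ)}
    (hA : A ∈ RHinf ι ι p) (hB : B ∈ RHinf ι ι p) (hC : C ∈ RHinf ι ι p) (hD : D ∈ RHinf ι ι p) :
    fromBlocks A B C D ∈ RHinf (ι ⊕ ι) (ι ⊕ ι) p := by
  rintro k (i | i) (j | j)
  exacts [hA k i j, hB k i j, hC k i j, hD k i j]

variable [NeZero p]

/-- The return difference of two proper stable tensors that satisfy the small gain condition is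
T-invertible over the ring of proper stable functions. -/
theorem tInvertible_of_small_gain {G H : Tensor (Fin m) (Fin m) p properStableSubring}
    (hgain : ∀ ω : ℝ, tSigmaMax (freqResponse (G.map properStableSubring.subtype) ω) *
      tSigmaMax (freqResponse (H.map properStableSubring.subtype) ω) < 1)
    (hinf : tSigmaMax (freqResponseAtInfty (G.map properStableSubring.subtype)) *
        tSigmaMax (freqResponseAtInfty (H.map properStableSubring.subtype)) < 1 ∨
      TInvertible (tId + tProd (freqResponseAtInfty (H.map properStableSubring.subtype))
        (freqResponseAtInfty (G.map properStableSubring.subtype)))) :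
    TInvertible (tId + tProd H G) := by
  have hmap : ∀ φ : properStableSubring →+* ℂ,
      φ (bcirc (tId + tProd H G)).det = (bcirc (tId + tProd (H.map φ) (G.map φ))).det := by
    intro φ
    rw [← det_bcirc_map, map_add, map_tId, map_tProd]
  rw [tInvertible_iff_isUnit_det]
  refine isUnit_of_eval_ne_zero (fun s hs => ?_) ?_
  · rw [hmap]
    exact det_bcirc_feedback_ne_zero _ _ fun k v h =>
      feedback_eq_zero_of_re_nonneg (fun k i j => (G k i j).2) (fun k i j => (H k i j).2)
        hgain hs k v h
  · rw [hmap]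
    rcases hinf with h | h
    · exact det_bcirc_feedback_ne_zero _ _ fun k v => feedback_eq_zero_of_tSigmaMax_mul_lt h k v
    · exact (tInvertible_iff_isUnit_det.1 h).ne_zero

/-- The feedback loop of proper stable tensors is stable if the return difference is T-invertible
over the ring of proper stable functions. -/
theorem feedbackStable_of_tInvertible {ι : Type*} [Fintype ι] [DecidableEq ι]
    {G H : Tensor ι ι p properStableSubring} (h : TInvertible (tId + tProd H G)) :
    FeedbackStable (G.map properStableSubring.subtype) (H.map properStableSubring.subtype) := by
  obtain ⟨X, hX⟩ := h
  have hX' := hX.map properStableSubring.subtype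
  rw [map_add, map_tId, map_tProd] at hX'
  refine ⟨⟨_, hX'⟩, ?_⟩
  rw [gangOfFour, hX'.tInv_eq, ← map_tProd, ← map_tProd, ← map_tProd]
  exact fromBlocks_mem_RHinf (map_subtype_mem_RHinf _) (map_subtype_mem_RHinf _)
    (map_subtype_mem_RHinf _) (map_subtype_mem_RHinf _)

end SmallGain

end Tensor

theorem mainTheorem8 (m p : ℕ) [NeZero p]
    (G H : Tensor (Fin m) (Fin m) p (RatFunc ℝ))
    (hG : G ∈ Tensor.RHinf (Fin m) (Fin m) p) (hH : H ∈ Tensor.RHinf (Fin m) (Fin m) p)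
    (hgain : ∀ ω : ℝ, Tensor.tSigmaMax (Tensor.freqResponse G ω) *
      Tensor.tSigmaMax (Tensor.freqResponse H ω) < 1)
    (hinf : Tensor.tSigmaMax (Tensor.freqResponseAtInfty G) *
        Tensor.tSigmaMax (Tensor.freqResponseAtInfty H) < 1 ∨
      Tensor.TInvertible (Tensor.tId +
        Tensor.tProd (Tensor.freqResponseAtInfty H) (Tensor.freqResponseAtInfty G))) :
    Tensor.FeedbackStable G H := by
  obtain ⟨G, rfl⟩ := Tensor.exists_map_subtype_eq hG
  obtain ⟨H, rfl⟩ := Tensor.exists_map_subtype_eq hH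
  exact Tensor.feedbackStable_of_tInvertible (Tensor.tInvertible_of_small_gain hgain hinf)
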